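/- Let $n\ge 0$ be an integer and let $P\in\mathbb{C}[x]$ be a polynomial of degree exactly $n$. For $s\in\mathbb{R}$ let $e^{-\frac s2((x\partial_x)^2-nx\partial_x)}:\mathbb{C}[x]\to\mathbb{C}[x]$ denote the linear operator determined by $$e^{-\frac s2((x\partial_x)^2-nx\partial_x)}\,x^k=e^{-\frac s2(k^2-nk)}\,x^k,\qquad k=0,1,2,\dots,$$ which is the exponential of the operator $-\frac s2((x\partial_x)^2-nx\partial_x)$. (a) (Positive case.) If all complex roots of $P$ are in $[0,\infty)$, then for every real $s\ge 0$ all complex roots of $e^{-\frac s2((x\partial_x)^2-nx\partial_x)}P$ are also in $[0,\infty)$. (b) (Unitary case.) If all complex roots of $P$ are on the unit circle $\{z\in\mathbb{C}:|z|=1\}$, then for every real $s\le 0$ all complex roots of $e^{-\frac s2((x\partial_x)^2-nx\partial_x)}P$ are also on the unit circle. -/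

import Mathlib

open Polynomial

noncomputable section

/-- The Euler operator `x ∂ₓ` on `ℂ[x]`. -/
def eulerOp : ℂ[X] →ₗ[ℂ] ℂ[X] :=
  LinearMap.mulLeft ℂ (X : ℂ[X]) ∘ₗ (derivative : ℂ[X] →ₗ[ℂ] ℂ[X])

/-- The generator `(x ∂ₓ)² - n x ∂ₓ`, a linear operator on `ℂ[x]`. -/
def heatGen (n : ℕ) : ℂ[X] →ₗ[ℂ] ℂ[X] :=
  eulerOp ∘ₗ eulerOp - (n : ℂ) • eulerOp

/-- The multiplicative heat operator `exp (-(s/2) ((x ∂ₓ)² - n x ∂ₓ))`: the linear operator on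
`ℂ[x]` with `x ^ k ↦ exp (-(s/2) (k² - n k)) x ^ k` for all `k`. It is the exponential series of
`-(s/2) • heatGen n`, see `hasSum_coeff_multHeat` below. -/
def multHeat (n : ℕ) (s : ℂ) : ℂ[X] →ₗ[ℂ] ℂ[X] :=
  Polynomial.lsum fun k : ℕ =>
    Complex.exp (-(s / 2) * ((k : ℂ) ^ 2 - n * k)) • (monomial k : ℂ →ₗ[ℂ] ℂ[X])

theorem coeff_eulerOp (P : ℂ[X]) (k : ℕ) : (eulerOp P).coeff k = k * P.coeff k := by
  cases k with
  | zero => simp [eulerOp]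
  | succ k => simp [eulerOp, coeff_X_mul, coeff_derivative, mul_comm]

theorem coeff_heatGen (n : ℕ) (P : ℂ[X]) (k : ℕ) :
    (heatGen n P).coeff k = ((k : ℂ) ^ 2 - n * k) * P.coeff k := by
  simp only [heatGen, LinearMap.sub_apply, LinearMap.comp_apply, LinearMap.smul_apply,
    coeff_sub, coeff_smul, coeff_eulerOp, smul_eq_mul]
  ring

theorem coeff_multHeat (n : ℕ) (s : ℂ) (P : ℂ[X]) (k : ℕ) :
    (multHeat n s P).coeff k =
      Complex.exp (-(s / 2) * ((k : ℂ) ^ 2 - n * k)) * P.coeff k := by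
  simp only [multHeat, lsum_apply, LinearMap.smul_apply, Polynomial.sum_def, finsetSum_coeff,
    coeff_smul, coeff_monomial, smul_eq_mul, mul_ite, mul_zero]
  rw [Finset.sum_ite_eq']
  split_ifs with h
  · rfl
  · rw [notMem_support_iff.mp h, mul_zero]

theorem multHeat_X_pow (n : ℕ) (s : ℂ) (k : ℕ) :
    multHeat n s (X ^ k) =
      Complex.exp (-(s / 2) * ((k : ℂ) ^ 2 - n * k)) • (X ^ k : ℂ[X]) := by
  ext j
  rw [coeff_multHeat, coeff_smul, smul_eq_mul, coeff_X_pow]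
  split_ifs with h
  · rw [h]
  · simp

/-- `multHeat n s` is the operator exponential `∑ m, (1 / m!) (-(s/2) • heatGen n) ^ m`,
with convergence of every coefficient. -/
theorem hasSum_coeff_multHeat (n : ℕ) (s : ℂ) (P : ℂ[X]) (k : ℕ) :
    HasSum (fun m : ℕ => ((m.factorial : ℂ)⁻¹ •
        (((-(s / 2)) • heatGen n : Module.End ℂ ℂ[X]) ^ m) P).coeff k)
      ((multHeat n s P).coeff k) := by
  have h : ∀ m : ℕ, ((((-(s / 2)) • heatGen n : Module.End ℂ ℂ[X]) ^ m) P).coeff k =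
      (-(s / 2) * ((k : ℂ) ^ 2 - n * k)) ^ m * P.coeff k := by
    intro m
    induction m with
    | zero => simp
    | succ m ih =>
      rw [pow_succ', Module.End.mul_apply, LinearMap.smul_apply, coeff_smul, coeff_heatGen, ih,
        smul_eq_mul]
      ring
  rw [coeff_multHeat, Complex.exp_eq_exp_ℂ]
  refine ((NormedSpace.exp_series_hasSum_exp' (𝕂 := ℂ)
    (-(s / 2) * ((k : ℂ) ^ 2 - n * k))).mul_right (P.coeff k)).congr_fun ?_
  intro m
  rw [coeff_smul, h, smul_eq_mul, smul_eq_mul, mul_assoc]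

end

/-! Completing the square, `exp (-s * n ^ 2 / 8)` times the heat multiplier of `x ^ k` is `exp (b ^
2 * (2 * k - n) ^ 2 / 2)` with `b ^ 2 = -s / 4`. As in the central limit theorem, this is the limit
of `cosh (b * (2 * k - n) / √N) ^ N`, so the heat flow is, up to a constant, a limit of iterates of
`coshMean`, with `b` real in the unitary case and imaginary in the positive case.

One step keeps the roots in place: its value at `z` is a sum of two products over the roots of `P`
(`eval_coshMean`), and for `z` off the circle (resp. off the real line) one product dominates the
other factor by factor, so they cannot cancel. Negative roots are excluded separately, by
alternation of coefficient signs. Root location then survives the limit because the degree does not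
drop (`mem_of_isRoot_of_tendsto_coeff`). -/

open Filter Topology

/-! ### The averaging step and its factorization over roots -/

/-- The mean of the two rescalings of `P` by `exp (± 2h)`, normalized symmetrically in degree `n`.
It multiplies the coefficient of `x ^ k` by `cosh (h (2k - n))`. -/
noncomputable def coshMean (n : ℕ) (h : ℂ) (P : Polynomial ℂ) : Polynomial ℂ :=
  Polynomial.C (Complex.exp (-h * n) / 2) *
      P.comp (Polynomial.C (Complex.exp (2 * h)) * Polynomial.X) +
    Polynomial.C (Complex.exp (h * n) / 2) *
      P.comp (Polynomial.C (Complex.exp (-(2 * h))) * Polynomial.X)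

theorem coeff_coshMean (n : ℕ) (h : ℂ) (P : Polynomial ℂ) (k : ℕ) :
    (coshMean n h P).coeff k = Complex.cosh (h * (2 * k - n)) * P.coeff k := by
  have e1 : Complex.exp (h * (2 * k - n)) =
      Complex.exp (-h * n) * Complex.exp (2 * h) ^ k := by
    rw [← Complex.exp_nat_mul, ← Complex.exp_add]; ring_nf
  have e2 : Complex.exp (-(h * (2 * k - n))) =
      Complex.exp (h * n) * Complex.exp (-(2 * h)) ^ k := by
    rw [← Complex.exp_nat_mul, ← Complex.exp_add]; ring_nf
  rw [coshMean, coeff_add, coeff_C_mul, coeff_C_mul, comp_C_mul_X_coeff, comp_C_mul_X_coeff,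
    Complex.cosh, e1, e2]
  ring

theorem coeff_iterate_coshMean (n : ℕ) (h : ℂ) (P : Polynomial ℂ) (k N : ℕ) :
    ((coshMean n h)^[N] P).coeff k = Complex.cosh (h * (2 * k - n)) ^ N * P.coeff k := by
  induction N with
  | zero => simp
  | succ N ih => rw [Function.iterate_succ_apply', coeff_coshMean, ih]; ring

theorem degree_coshMean {n : ℕ} {h : ℂ} {P : Polynomial ℂ} (hP : P.degree = n)
    (hh : Complex.cosh (h * n) ≠ 0) : (coshMean n h P).degree = n := by
  apply le_antisymm
  · rw [degree_le_iff_coeff_zero]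
    intro m hm
    rw [coeff_coshMean, coeff_eq_zero_of_degree_lt (hP ▸ hm), mul_zero]
  · apply le_degree_of_ne_zero
    rw [coeff_coshMean]
    refine mul_ne_zero ?_ (coeff_ne_zero_of_eq_degree hP)
    rwa [two_mul, add_sub_cancel_right]

theorem eval_eq_leadingCoeff_mul_prod_roots (P : Polynomial ℂ) (z : ℂ) :
    P.eval z = P.leadingCoeff * (P.roots.map fun a => z - a).prod := by
  conv_lhs => rw [(IsAlgClosed.splits P).eq_prod_roots]
  rw [eval_mul, eval_C, eval_multiset_prod, Multiset.map_map]
  simp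

/-- There are exactly `n` roots, so `exp (-h * n)` can be shared out as one `exp (-h)` per linear
factor. -/
theorem exp_mul_eval_exp_mul {n : ℕ} {P : Polynomial ℂ} (hP : P.degree = n) (h z : ℂ) :
    Complex.exp (-h * n) * P.eval (Complex.exp (2 * h) * z) = P.leadingCoeff *
      (P.roots.map fun a => Complex.exp h * z - Complex.exp (-h) * a).prod := by
  have hc : P.roots.card = n := by
    rw [← (IsAlgClosed.splits P).natDegree_eq_card_roots]
    exact natDegree_eq_of_degree_eq_some hP
  have e : ∀ a, Complex.exp h * z - Complex.exp (-h) * a =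
      Complex.exp (-h) * (Complex.exp (2 * h) * z - a) := by
    intro a
    rw [mul_sub, ← mul_assoc, ← Complex.exp_add]
    ring_nf
  simp_rw [e]
  rw [Multiset.prod_map_mul, Multiset.map_const', Multiset.prod_replicate, hc,
    eval_eq_leadingCoeff_mul_prod_roots, ← Complex.exp_nat_mul]
  ring_nf

theorem eval_coshMean {n : ℕ} {P : Polynomial ℂ} (hP : P.degree = n) (h z : ℂ) :
    (coshMean n h P).eval z = P.leadingCoeff / 2 *
      ((P.roots.map fun a => Complex.exp h * z - Complex.exp (-h) * a).prod +
        (P.roots.map fun a => Complex.exp (-h) * z - Complex.exp h * a).prod) := by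
  have h1 := exp_mul_eval_exp_mul hP h z
  have h2 := exp_mul_eval_exp_mul hP (-h) z
  simp only [neg_neg, mul_neg] at h2
  simp only [coshMean, eval_add, eval_mul, eval_C, eval_comp, eval_X]
  linear_combination h1 / 2 + h2 / 2

/-! ### Non-cancellation of the two products -/

/-- Strictness is asked at one index only, since a root `0` of `P` gives equal norms in the positive
case; the nonvanishing of `v` keeps the strict inequality alive. -/
theorem Multiset.norm_prod_map_lt_norm_prod_map {α : Type*} (s : Multiset α) (u v : α → ℂ)
    (hle : ∀ a ∈ s, ‖u a‖ ≤ ‖v a‖) (hv : ∀ a ∈ s, v a ≠ 0) (hlt : ∃ a ∈ s, ‖u a‖ < ‖v a‖) :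
    ‖(s.map u).prod‖ < ‖(s.map v).prod‖ := by
  have key : ∀ t : Multiset α, (∀ a ∈ t, ‖u a‖ ≤ ‖v a‖) → (∀ a ∈ t, v a ≠ 0) →
      ‖(t.map u).prod‖ ≤ ‖(t.map v).prod‖ ∧ 0 < ‖(t.map v).prod‖ := by
    intro t
    induction t using Multiset.induction_on with
    | empty => simp
    | cons a t ih =>
      intro h1 h2
      obtain ⟨i1, i2⟩ := ih (fun b hb => h1 b (Multiset.mem_cons_of_mem hb))
        (fun b hb => h2 b (Multiset.mem_cons_of_mem hb))
      have := h1 a (Multiset.mem_cons_self a t)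
      have := norm_pos_iff.2 (h2 a (Multiset.mem_cons_self a t))
      simp only [Multiset.map_cons, Multiset.prod_cons, norm_mul]
      exact ⟨by gcongr, by positivity⟩
  obtain ⟨a, ha, hau⟩ := hlt
  obtain ⟨t, rfl⟩ := Multiset.exists_cons_of_mem ha
  obtain ⟨i1, i2⟩ := key t (fun b hb => hle b (Multiset.mem_cons_of_mem hb))
    (fun b hb => hv b (Multiset.mem_cons_of_mem hb))
  simp only [Multiset.map_cons, Multiset.prod_cons, norm_mul]
  calc ‖u a‖ * ‖(t.map u).prod‖ ≤ ‖u a‖ * ‖(t.map v).prod‖ := by gcongr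
    _ < ‖v a‖ * ‖(t.map v).prod‖ := by gcongr

theorem eval_coshMean_ne_zero_of_lt {n : ℕ} {P : Polynomial ℂ} (hP : P.degree = n) (h z : ℂ)
    (hle : ∀ a ∈ P.roots, ‖Complex.exp h * z - Complex.exp (-h) * a‖ ≤
      ‖Complex.exp (-h) * z - Complex.exp h * a‖)
    (hv : ∀ a ∈ P.roots, Complex.exp (-h) * z - Complex.exp h * a ≠ 0)
    (hlt : ∃ a ∈ P.roots, ‖Complex.exp h * z - Complex.exp (-h) * a‖ <
      ‖Complex.exp (-h) * z - Complex.exp h * a‖) :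
    (coshMean n h P).eval z ≠ 0 := by
  have hP0 : P ≠ 0 := by rintro rfl; simp at hP
  have := P.roots.norm_prod_map_lt_norm_prod_map _ _ hle hv hlt
  rw [eval_coshMean hP]
  refine mul_ne_zero (div_ne_zero (leadingCoeff_ne_zero.2 hP0) two_ne_zero) fun h0 => ?_
  rw [eq_neg_of_add_eq_zero_left h0, norm_neg] at this
  exact lt_irrefl _ this

theorem coshMean_neg (n : ℕ) (h : ℂ) (P : Polynomial ℂ) : coshMean n (-h) P = coshMean n h P := by
  ext k
  rw [coeff_coshMean, coeff_coshMean, neg_mul, Complex.cosh_neg]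

/-- If `0` is the only possible root of `P`, the same holds for `coshMean n h P`. -/
theorem eval_coshMean_ne_zero_of_roots_eq_zero {n : ℕ} {P : Polynomial ℂ} (hP : P.degree = n)
    {h z : ℂ} (hh : Complex.cosh (h * n) ≠ 0) (hz : z ≠ 0 ∨ n = 0) (h0 : ∀ a ∈ P.roots, a = 0) :
    (coshMean n h P).eval z ≠ 0 := by
  have hP0 : P ≠ 0 := by rintro rfl; simp at hP
  have hc : P.roots.card = n := by
    rw [← (IsAlgClosed.splits P).natDegree_eq_card_roots]
    exact natDegree_eq_of_degree_eq_some hP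
  rw [eval_coshMean hP, Multiset.eq_replicate.2 ⟨hc, h0⟩]
  simp only [Multiset.map_replicate, Multiset.prod_replicate, mul_zero, sub_zero, mul_pow]
  rw [← add_mul, ← Complex.exp_nat_mul, ← Complex.exp_nat_mul]
  refine mul_ne_zero (div_ne_zero (leadingCoeff_ne_zero.2 hP0) two_ne_zero)
    (mul_ne_zero ?_ ?_)
  · intro h1
    apply hh
    rw [Complex.cosh, mul_comm h, ← mul_neg, h1, zero_div]
  · rcases hz with hz | rfl
    · exact pow_ne_zero _ hz
    · simp

/-! ### Comparison of factors, and the unitary step -/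

theorem norm_sq_exp_mul_sub_of_real (x : ℝ) (z a : ℂ) :
    ‖Complex.exp x * z - Complex.exp (-x) * a‖ ^ 2 - ‖Complex.exp (-x) * z - Complex.exp x * a‖ ^ 2
      = (Real.exp x ^ 2 - Real.exp (-x) ^ 2) * (‖z‖ ^ 2 - ‖a‖ ^ 2) := by
  rw [← Complex.ofReal_neg, ← Complex.ofReal_exp, ← Complex.ofReal_exp]
  simp only [Complex.sq_norm, Complex.normSq_apply, Complex.sub_re, Complex.sub_im,
    Complex.re_ofReal_mul, Complex.im_ofReal_mul]
  ring

theorem norm_sq_exp_mul_sub_of_imag (t a : ℝ) (z : ℂ) :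
    ‖Complex.exp (t * Complex.I) * z - Complex.exp (-(t * Complex.I)) * a‖ ^ 2 -
      ‖Complex.exp (-(t * Complex.I)) * z - Complex.exp (t * Complex.I) * a‖ ^ 2
      = 4 * a * Real.sin (2 * t) * z.im := by
  have e : Complex.exp (-(t * Complex.I)) = ⟨Real.cos t, -Real.sin t⟩ := by
    rw [← neg_mul, ← Complex.ofReal_neg]
    apply Complex.ext <;> simp [Complex.exp_ofReal_mul_I_re, Complex.exp_ofReal_mul_I_im,
      -Complex.ofReal_neg]
  have e' : Complex.exp (t * Complex.I) = ⟨Real.cos t, Real.sin t⟩ := by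
    apply Complex.ext <;> simp [Complex.exp_ofReal_mul_I_re, Complex.exp_ofReal_mul_I_im]
  rw [e, e', Real.sin_two_mul]
  simp only [Complex.sq_norm, Complex.normSq_apply, Complex.sub_re, Complex.sub_im,
    Complex.mul_re, Complex.mul_im, Complex.ofReal_re, Complex.ofReal_im]
  ring

theorem norm_eq_one_of_isRoot_coshMean {n : ℕ} {P : Polynomial ℂ} (hP : P.degree = n)
    (hr : ∀ z, P.IsRoot z → ‖z‖ = 1) {x : ℝ} (hx : 0 < x) {z : ℂ}
    (hz : (coshMean n x P).IsRoot z) : ‖z‖ = 1 := by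
  by_contra hne
  have hP0 : P ≠ 0 := by rintro rfl; simp at hP
  have hr' : ∀ a ∈ P.roots, ‖a‖ = 1 := fun a ha => hr a (isRoot_of_mem_roots ha)
  have hexp : 0 < Real.exp x ^ 2 - Real.exp (-x) ^ 2 := by
    have : Real.exp (-x) < Real.exp x := Real.exp_lt_exp.2 (by linarith)
    nlinarith [Real.exp_pos (-x)]
  rcases Nat.eq_zero_or_pos n with rfl | hn
  · refine eval_coshMean_ne_zero_of_roots_eq_zero hP (by simp) (Or.inr rfl) ?_ hz
    have : P.roots = 0 := by rw [eq_C_of_degree_eq_zero hP, roots_C]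
    simp [this]
  obtain ⟨a₀, ha₀⟩ : ∃ a, a ∈ P.roots := by
    obtain ⟨a, ha⟩ := IsAlgClosed.exists_root P (by rw [hP]; exact_mod_cast hn.ne')
    exact ⟨a, (mem_roots hP0).2 ha⟩
  rcases lt_or_gt_of_ne hne with h | h
  · have key : ∀ a ∈ P.roots, ‖Complex.exp x * z - Complex.exp (-x) * a‖ <
        ‖Complex.exp (-x) * z - Complex.exp x * a‖ := by
      intro a ha
      refine lt_of_pow_lt_pow_left₀ 2 (norm_nonneg _) (sub_neg.1 ?_)
      rw [norm_sq_exp_mul_sub_of_real, hr' a ha]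
      exact mul_neg_of_pos_of_neg hexp (by nlinarith [norm_nonneg z])
    exact eval_coshMean_ne_zero_of_lt hP x z (fun a ha => (key a ha).le)
      (fun a ha => norm_pos_iff.1 ((norm_nonneg _).trans_lt (key a ha))) ⟨a₀, ha₀, key a₀ ha₀⟩ hz
  -- Outside the circle the other product dominates; evenness in `h` (`coshMean_neg`) swaps the two.
  · have key : ∀ a ∈ P.roots, ‖Complex.exp (-x) * z - Complex.exp (- -x) * a‖ <
        ‖Complex.exp (- -x) * z - Complex.exp (-x) * a‖ := by
      intro a ha
      rw [neg_neg]
      refine lt_of_pow_lt_pow_left₀ 2 (norm_nonneg _) (sub_pos.1 ?_)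
      rw [norm_sq_exp_mul_sub_of_real, hr' a ha]
      exact mul_pos hexp (by nlinarith [norm_nonneg z])
    rw [← coshMean_neg] at hz
    exact eval_coshMean_ne_zero_of_lt hP (-x) z (fun a ha => (key a ha).le)
      (fun a ha => norm_pos_iff.1 ((norm_nonneg _).trans_lt (key a ha))) ⟨a₀, ha₀, key a₀ ha₀⟩ hz

/-! ### The positive step -/

/-- The coefficients of a monic polynomial with nonnegative roots alternate in sign. -/
theorem exists_coeff_prod_X_sub_C_eq (s : Multiset ℂ) (hs : ∀ a ∈ s, ∃ x : ℝ, 0 ≤ x ∧ a = x) :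
    ∀ k, ∃ r : ℝ, 0 ≤ r ∧
      (s.map fun a => (Polynomial.X - Polynomial.C a)).prod.coeff k = ((-1) ^ (s.card + k) * r : ℂ) := by
  induction s using Multiset.induction_on with
  | empty =>
    rintro (_ | k)
    · exact ⟨1, by simp⟩
    · exact ⟨0, by simp [coeff_one]⟩
  | cons a s ih =>
    have ih := ih fun b hb => hs b (Multiset.mem_cons_of_mem hb)
    obtain ⟨x, hx, rfl⟩ := hs a (Multiset.mem_cons_self a s)
    rintro (_ | k)
    · obtain ⟨r, hr, h⟩ := ih 0
      refine ⟨x * r, by positivity, ?_⟩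
      simp only [Multiset.map_cons, Multiset.prod_cons, mul_coeff_zero, h, Multiset.card_cons]
      simp
      ring
    · obtain ⟨r, hr, h⟩ := ih k
      obtain ⟨r', hr', h'⟩ := ih (k + 1)
      refine ⟨r + x * r', by positivity, ?_⟩
      simp only [Multiset.map_cons, Multiset.prod_cons, sub_mul, coeff_sub, coeff_X_mul,
        coeff_C_mul, h, h', Multiset.card_cons]
      push_cast
      ring

/-- Multiplying the coefficients of a polynomial with nonnegative roots by positive numbers
does not create negative roots. -/
theorem eval_neg_ne_zero_of_coeff_eq_mul {P Q : Polynomial ℂ} (hP : P ≠ 0)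
    (hr : ∀ z, P.IsRoot z → ∃ x : ℝ, 0 ≤ x ∧ z = x) (m : ℕ → ℝ)
    (hm : ∀ k ≤ P.natDegree, 0 < m k) (hQ : ∀ k, Q.coeff k = m k * P.coeff k)
    {t : ℝ} (ht : 0 < t) : Q.eval (-t : ℂ) ≠ 0 := by
  choose r hr0 hr1 using exists_coeff_prod_X_sub_C_eq P.roots
    fun a ha => hr a (isRoot_of_mem_roots ha)
  have hP' : ∀ k, P.coeff k = P.leadingCoeff * ((-1) ^ (P.natDegree + k) * r k) := by
    intro k
    conv_lhs => rw [(IsAlgClosed.splits P).eq_prod_roots]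
    rw [coeff_C_mul, hr1, (IsAlgClosed.splits P).natDegree_eq_card_roots]
  have hdeg : Q.natDegree < P.natDegree + 1 := by
    rw [Nat.lt_succ_iff, natDegree_le_iff_coeff_eq_zero]
    intro k hk
    rw [hQ, coeff_eq_zero_of_natDegree_lt hk, mul_zero]
  have hsum : Q.eval (-t : ℂ) = P.leadingCoeff * (-1) ^ P.natDegree *
      ((∑ k ∈ Finset.range (P.natDegree + 1), m k * r k * t ^ k : ℝ) : ℂ) := by
    rw [eval_eq_sum_range' hdeg]
    push_cast
    rw [Finset.mul_sum]
    refine Finset.sum_congr rfl fun k _ => ?_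
    rw [hQ, hP', neg_pow (t : ℂ), pow_add]
    have : ((-1 : ℂ) ^ k) * (-1) ^ k = 1 := by rw [← mul_pow]; simp
    linear_combination (m k * P.leadingCoeff * (-1) ^ P.natDegree * r k * t ^ k : ℂ) * this
  have hlead := leadingCoeff_ne_zero.2 hP
  rw [hsum]
  refine mul_ne_zero (mul_ne_zero hlead (by simp)) (Complex.ofReal_ne_zero.2 (ne_of_gt ?_))
  refine Finset.sum_pos' (fun k hk => ?_) ⟨P.natDegree, by simp, ?_⟩
  · have := hm k (by simpa [Nat.lt_succ_iff] using hk)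
    have := hr0 k
    positivity
  · have h1 := hm _ le_rfl
    have h2 : 0 < r P.natDegree := by
      refine lt_of_le_of_ne (hr0 _) fun h => ?_
      have := hP' P.natDegree
      rw [← h, Complex.ofReal_zero, mul_zero, mul_zero] at this
      exact hlead this
    positivity

theorem cos_mul_two_mul_sub_pos {n k : ℕ} (hk : k ≤ n) {t : ℝ} (ht : 0 < t)
    (htn : t * (n + 1) < Real.pi / 2) : 0 < Real.cos (t * (2 * k - n)) := by
  have hk' : (k : ℝ) ≤ n := by exact_mod_cast hk
  have hk0 : (0 : ℝ) ≤ k := k.cast_nonneg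
  apply Real.cos_pos_of_mem_Ioo
  constructor <;> nlinarith

theorem cosh_mul_I_mul (t : ℝ) (n k : ℕ) :
    Complex.cosh (t * Complex.I * (2 * k - n)) = (Real.cos (t * (2 * k - n)) : ℝ) := by
  rw [mul_right_comm, Complex.cosh_mul_I]
  push_cast
  rfl

theorem cosh_mul_I_mul_ne_zero {n : ℕ} {t : ℝ} (ht : 0 < t) (htn : t * (n + 1) < Real.pi / 2) :
    Complex.cosh (t * Complex.I * n) ≠ 0 := by
  have := cosh_mul_I_mul t n n
  rw [two_mul, add_sub_cancel_right] at this
  rw [this]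
  exact Complex.ofReal_ne_zero.2 (cos_mul_two_mul_sub_pos le_rfl ht htn).ne'

theorem nonneg_of_isRoot_coshMean {n : ℕ} {P : Polynomial ℂ} (hP : P.degree = n)
    (hr : ∀ z, P.IsRoot z → ∃ x : ℝ, 0 ≤ x ∧ z = x) {t : ℝ} (ht : 0 < t)
    (htn : t * (n + 1) < Real.pi / 2) {z : ℂ} (hz : (coshMean n (t * Complex.I) P).IsRoot z) :
    ∃ x : ℝ, 0 ≤ x ∧ z = x := by
  have hP0 : P ≠ 0 := by rintro rfl; simp at hP
  have hnd := natDegree_eq_of_degree_eq_some hP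
  have hr' : ∀ a ∈ P.roots, ∃ x : ℝ, 0 ≤ x ∧ a = x := fun a ha => hr a (isRoot_of_mem_roots ha)
  -- The `n + 1` in `htn` ensures `2 * t < π` even when `n = 0`.
  have hsin : 0 < Real.sin (2 * t) := by
    have : (0 : ℝ) ≤ n := n.cast_nonneg
    apply Real.sin_pos_of_pos_of_lt_pi <;> nlinarith
  have him : z.im = 0 := by
    by_contra him
    have hz0 : z ≠ 0 := by rintro rfl; simp at him
    -- With only zero roots no factor is strictly dominated; `P` is then a monomial and is treated
    -- directly.
    by_cases h0 : ∀ a ∈ P.roots, a = 0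
    · exact eval_coshMean_ne_zero_of_roots_eq_zero hP (cosh_mul_I_mul_ne_zero ht htn)
        (Or.inl hz0) h0 hz
    push Not at h0
    obtain ⟨a₀, ha₀, hne⟩ := h0
    rcases lt_or_gt_of_ne him with h | h
    · have key : ∀ a ∈ P.roots, a ≠ 0 →
          ‖Complex.exp (t * Complex.I) * z - Complex.exp (-(t * Complex.I)) * a‖ <
          ‖Complex.exp (-(t * Complex.I)) * z - Complex.exp (t * Complex.I) * a‖ := by
        intro a ha ha0
        obtain ⟨x, hx, rfl⟩ := hr' a ha
        have hx : 0 < x := lt_of_le_of_ne hx fun h => ha0 (by simp [← h])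
        refine lt_of_pow_lt_pow_left₀ 2 (norm_nonneg _) (sub_neg.1 ?_)
        rw [norm_sq_exp_mul_sub_of_imag]
        exact mul_neg_of_pos_of_neg (by positivity) h
      refine eval_coshMean_ne_zero_of_lt hP _ z (fun a ha => ?_) (fun a ha => ?_)
        ⟨a₀, ha₀, key a₀ ha₀ hne⟩ hz
      · by_cases ha0 : a = 0
        · simp [ha0, Complex.norm_exp]
        · exact (key a ha ha0).le
      · by_cases ha0 : a = 0
        · simp [ha0, hz0]
        · exact norm_pos_iff.1 ((norm_nonneg _).trans_lt (key a ha ha0))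
    · have key : ∀ a ∈ P.roots, a ≠ 0 →
          ‖Complex.exp (-(t * Complex.I)) * z - Complex.exp (- -(t * Complex.I)) * a‖ <
          ‖Complex.exp (- -(t * Complex.I)) * z - Complex.exp (-(t * Complex.I)) * a‖ := by
        intro a ha ha0
        obtain ⟨x, hx, rfl⟩ := hr' a ha
        have hx : 0 < x := lt_of_le_of_ne hx fun h => ha0 (by simp [← h])
        rw [neg_neg]
        refine lt_of_pow_lt_pow_left₀ 2 (norm_nonneg _) (sub_pos.1 ?_)
        rw [norm_sq_exp_mul_sub_of_imag]
        positivity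
      rw [← coshMean_neg] at hz
      refine eval_coshMean_ne_zero_of_lt hP _ z (fun a ha => ?_) (fun a ha => ?_)
        ⟨a₀, ha₀, key a₀ ha₀ hne⟩ hz
      · by_cases ha0 : a = 0
        · simp [ha0, Complex.norm_exp]
        · exact (key a ha ha0).le
      · by_cases ha0 : a = 0
        · simp [ha0, hz0]
        · exact norm_pos_iff.1 ((norm_nonneg _).trans_lt (key a ha ha0))
  have hzr : z = (z.re : ℂ) := by apply Complex.ext <;> simp [him]
  refine ⟨z.re, ?_, hzr⟩
  by_contra! hneg
  refine eval_neg_ne_zero_of_coeff_eq_mul hP0 hr (fun k => Real.cos (t * (2 * k - n)))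
    (fun k hk => cos_mul_two_mul_sub_pos (hnd ▸ hk) ht htn)
    (fun k => by rw [coeff_coshMean, cosh_mul_I_mul]) (t := -z.re) (by linarith) ?_
  rw [Complex.ofReal_neg, neg_neg, ← hzr]
  exact hz

/-! ### Passage to the limit -/

/-- From `cosh w - 1 = 2 * sinh (w / 2) ^ 2` and the derivative of `sinh` at `0`, `N * (cosh (b /
√N) - 1)` tends to `b ^ 2 / 2`; then `(1 + x / N) ^ N` asymptotics apply. -/
theorem tendsto_cosh_div_sqrt_pow (b : ℂ) :
    Tendsto (fun N : ℕ => Complex.cosh (b / (√(N : ℝ) : ℝ)) ^ N) atTop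
      (𝓝 (Complex.exp (b ^ 2 / 2))) := by
  have hsq : Tendsto (fun N : ℕ => (((√(N : ℝ) : ℝ) : ℂ))⁻¹) atTop (𝓝[≠] 0) := by
    rw [tendsto_nhdsWithin_iff]
    constructor
    · have h1 : Tendsto (fun N : ℕ => (√(N : ℝ))⁻¹) atTop (𝓝 0) :=
        tendsto_inv_atTop_zero.comp (Real.tendsto_sqrt_atTop.comp tendsto_natCast_atTop_atTop)
      have := (Complex.continuous_ofReal.tendsto 0).comp h1
      simpa [Function.comp_def] using this
    · filter_upwards [eventually_gt_atTop 0] with N hN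
      have : 0 < √(N : ℝ) := Real.sqrt_pos.2 (by exact_mod_cast hN)
      simpa using hN.ne'
  have hd : HasDerivAt (fun w : ℂ => Complex.sinh (b / 2 * w)) (b / 2) 0 := by
    have := ((hasDerivAt_id (0 : ℂ)).const_mul (b / 2)).csinh
    simpa using this
  have hs := ((hasDerivAt_iff_tendsto_slope_zero.1 hd).comp hsq).pow 2 |>.const_mul 2
  have hlim : Tendsto (fun N : ℕ => (N : ℂ) * (Complex.cosh (b / (√(N : ℝ) : ℝ)) - 1)) atTop
      (𝓝 (b ^ 2 / 2)) := by
    have e : 2 * (b / 2) ^ 2 = b ^ 2 / 2 := by ring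
    rw [e] at hs
    refine hs.congr fun N => ?_
    have hN : ((√(N : ℝ) : ℝ) : ℂ) ^ 2 = N := by
      rw [← Complex.ofReal_pow, Real.sq_sqrt N.cast_nonneg]; simp
    have hc : Complex.cosh (b / (√(N : ℝ) : ℝ)) - 1 =
        2 * Complex.sinh (b / 2 * (((√(N : ℝ) : ℝ) : ℂ))⁻¹) ^ 2 := by
      have e : b / (√(N : ℝ) : ℝ) = 2 * (b / 2 * (((√(N : ℝ) : ℝ) : ℂ))⁻¹) := by ring
      rw [e, Complex.cosh_two_mul, Complex.cosh_sq]
      ring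
    rw [hc]
    simp only [Function.comp_apply, zero_add, mul_zero, Complex.sinh_zero, sub_zero, inv_inv,
      smul_eq_mul, mul_pow, hN]
    ring
  have := Complex.tendsto_one_add_pow_exp_of_tendsto hlim
  simpa using this

/-- Each factor `z - a` has norm at least the distance to `S`. This quantitative bound takes the
place of Hurwitz's theorem. -/
theorem norm_leadingCoeff_mul_infDist_pow_le {S : Set ℂ} {P : Polynomial ℂ}
    (hr : ∀ z, P.IsRoot z → z ∈ S) (z : ℂ) :
    ‖P.leadingCoeff‖ * Metric.infDist z S ^ P.natDegree ≤ ‖P.eval z‖ := by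
  have key : ∀ s : Multiset ℂ, (∀ a ∈ s, a ∈ S) →
      Metric.infDist z S ^ s.card ≤ ‖(s.map fun a => z - a).prod‖ := by
    intro s
    induction s using Multiset.induction_on with
    | empty => simp
    | cons a s ih =>
      intro h
      have h1 := ih fun b hb => h b (Multiset.mem_cons_of_mem hb)
      have h2 : Metric.infDist z S ≤ ‖z - a‖ := by
        rw [← dist_eq_norm]
        exact Metric.infDist_le_dist_of_mem (h a (Multiset.mem_cons_self a s))
      rw [Multiset.card_cons, pow_succ', Multiset.map_cons, Multiset.prod_cons, norm_mul]
      have := Metric.infDist_nonneg (x := z) (s := S)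
      gcongr
  rw [eval_eq_leadingCoeff_mul_prod_roots, norm_mul,
    (IsAlgClosed.splits P).natDegree_eq_card_roots]
  gcongr
  exact key _ fun a ha => hr a (isRoot_of_mem_roots ha)

/-- A closed set containing all roots of degree `n` polynomials contains all roots of their
coefficientwise limit of degree `n`. -/
theorem mem_of_isRoot_of_tendsto_coeff {S : Set ℂ} (hS : IsClosed S) (hne : S.Nonempty) {n : ℕ}
    {F : ℕ → Polynomial ℂ} {Q : Polynomial ℂ} (hQ : Q.degree = n)
    (hF : ∀ᶠ N in atTop, (F N).degree = n ∧ ∀ z, (F N).IsRoot z → z ∈ S)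
    (hlim : ∀ k, Tendsto (fun N => (F N).coeff k) atTop (𝓝 (Q.coeff k)))
    {z : ℂ} (hz : Q.IsRoot z) : z ∈ S := by
  have heval : Tendsto (fun N => ‖(F N).eval z‖) atTop (𝓝 0) := by
    have h1 : Tendsto (fun N => ∑ k ∈ Finset.range (n + 1), (F N).coeff k * z ^ k) atTop
        (𝓝 (∑ k ∈ Finset.range (n + 1), Q.coeff k * z ^ k)) :=
      tendsto_finsetSum _ fun k _ => (hlim k).mul_const _
    rw [← natDegree_eq_of_degree_eq_some hQ, ← eval_eq_sum_range, hz.eq_zero,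
      natDegree_eq_of_degree_eq_some hQ] at h1
    rw [← norm_zero (E := ℂ)]
    refine (h1.congr' ?_).norm
    filter_upwards [hF] with N hN
    rw [← natDegree_eq_of_degree_eq_some hN.1, ← eval_eq_sum_range]
  have hle : ‖Q.coeff n‖ * Metric.infDist z S ^ n ≤ 0 := by
    refine le_of_tendsto_of_tendsto ((hlim n).norm.mul_const _) heval ?_
    filter_upwards [hF] with N hN
    have hd := natDegree_eq_of_degree_eq_some hN.1
    have := norm_leadingCoeff_mul_infDist_pow_le hN.2 z
    rwa [leadingCoeff, hd] at this
  have hc : 0 < ‖Q.coeff n‖ := norm_pos_iff.2 (coeff_ne_zero_of_eq_degree hQ)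
  rw [hS.mem_iff_infDist_zero hne]
  by_contra h
  have : 0 < Metric.infDist z S := lt_of_le_of_ne Metric.infDist_nonneg (Ne.symm h)
  have : 0 < ‖Q.coeff n‖ * Metric.infDist z S ^ n := by positivity
  linarith

theorem mem_of_isRoot_multHeat {S : Set ℂ} (hS : IsClosed S) (hne : S.Nonempty) {n : ℕ}
    {b s : ℂ} (hb : b ^ 2 = -s / 4)
    (hstep : ∀ᶠ N : ℕ in atTop, Complex.cosh (b / (√(N : ℝ) : ℝ) * n) ≠ 0 ∧
      ∀ P : Polynomial ℂ, P.degree = n → (∀ z, P.IsRoot z → z ∈ S) →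
        ∀ z, (coshMean n (b / (√(N : ℝ) : ℝ)) P).IsRoot z → z ∈ S)
    {P : Polynomial ℂ} (hP : P.degree = n) (hr : ∀ z, P.IsRoot z → z ∈ S)
    {z : ℂ} (hz : (multHeat n s P).IsRoot z) : z ∈ S := by
  -- The constant term left by completing the square; it does not affect roots.
  set c := Complex.exp (-s * n ^ 2 / 8)
  have hc : c ≠ 0 := Complex.exp_ne_zero _
  have hdeg : (Polynomial.C c * multHeat n s P).degree = n := by
    rw [degree_C_mul hc]
    apply le_antisymm
    · rw [degree_le_iff_coeff_zero]
      intro m hm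
      rw [coeff_multHeat, coeff_eq_zero_of_degree_lt (hP ▸ hm), mul_zero]
    · apply le_degree_of_ne_zero
      rw [coeff_multHeat]
      exact mul_ne_zero (Complex.exp_ne_zero _) (coeff_ne_zero_of_eq_degree hP)
  refine mem_of_isRoot_of_tendsto_coeff hS hne hdeg
    (F := fun N => (coshMean n (b / (√(N : ℝ) : ℝ)))^[N] P) ?_ (fun k => ?_) (z := z) ?_
  · filter_upwards [hstep] with N hN
    have : ∀ M : ℕ, ((coshMean n (b / (√(N : ℝ) : ℝ)))^[M] P).degree = n ∧
        ∀ z, ((coshMean n (b / (√(N : ℝ) : ℝ)))^[M] P).IsRoot z → z ∈ S := by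
      intro M
      induction M with
      | zero => exact ⟨hP, hr⟩
      | succ M ih =>
        rw [Function.iterate_succ_apply']
        exact ⟨degree_coshMean ih.1 hN.1, hN.2 _ ih.1 ih.2⟩
    exact this N
  · simp_rw [coeff_iterate_coshMean]
    rw [coeff_C_mul, coeff_multHeat, ← mul_assoc, ← Complex.exp_add]
    have h := tendsto_cosh_div_sqrt_pow (b * (2 * k - n))
    have e : (b * (2 * k - n)) ^ 2 / 2 =
        -s * n ^ 2 / 8 + -(s / 2) * ((k : ℂ) ^ 2 - n * k) := by
      rw [mul_pow, hb]; ring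
    rw [e] at h
    refine Tendsto.mul_const _ (h.congr fun N => ?_)
    rw [mul_div_right_comm]
  · rw [IsRoot.def, eval_mul, hz.eq_zero, mul_zero]

theorem multHeat_zero (n : ℕ) (P : Polynomial ℂ) : multHeat n 0 P = P := by
  ext k
  simp [coeff_multHeat]

theorem tendsto_div_sqrt_natCast (c : ℝ) :
    Tendsto (fun N : ℕ => c / √(N : ℝ)) atTop (𝓝 0) :=
  tendsto_const_nhds.div_atTop (Real.tendsto_sqrt_atTop.comp tendsto_natCast_atTop_atTop)

/-! ### The two cases -/

theorem mainTheorem9 (n : ℕ) (P : Polynomial ℂ) (hP : P.degree = (n : WithBot ℕ)) :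
    ((∀ z : ℂ, P.IsRoot z → ∃ x : ℝ, 0 ≤ x ∧ z = (x : ℂ)) →
      ∀ s : ℝ, 0 ≤ s →
        ∀ z : ℂ, (multHeat n (s : ℂ) P).IsRoot z → ∃ x : ℝ, 0 ≤ x ∧ z = (x : ℂ)) ∧
    ((∀ z : ℂ, P.IsRoot z → ‖z‖ = 1) →
      ∀ s : ℝ, s ≤ 0 → ∀ z : ℂ, (multHeat n (s : ℂ) P).IsRoot z → ‖z‖ = 1) := by
  constructor
  · intro hr s hs z hz
    rcases hs.eq_or_lt with rfl | hs
    · rw [Complex.ofReal_zero, multHeat_zero] at hz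
      exact hr z hz
    have hclosed : IsClosed {z : ℂ | ∃ x : ℝ, 0 ≤ x ∧ z = (x : ℂ)} := by
      have := Complex.isometry_ofReal.isClosedEmbedding.isClosedMap _ (isClosed_Ici (a := (0 : ℝ)))
      convert this using 1
      ext w
      simp [eq_comm]
    refine mem_of_isRoot_multHeat hclosed ⟨0, 0, le_rfl, by simp⟩
      (b := ((√s / 2 : ℝ) : ℂ) * Complex.I) ?_ ?_ hP hr hz
    · rw [mul_pow, Complex.I_sq, ← Complex.ofReal_pow, div_pow, Real.sq_sqrt hs.le]
      push_cast
      ring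
    · have hlim : Tendsto (fun N : ℕ => √s / 2 / √(N : ℝ) * (n + 1)) atTop (𝓝 0) := by
        simpa using (tendsto_div_sqrt_natCast (√s / 2)).mul_const ((n : ℝ) + 1)
      -- Large `N` makes the rotation angle small enough for all the cosine multipliers to be
      -- positive.
      filter_upwards [eventually_gt_atTop 0,
        hlim.eventually_lt_const (show (0 : ℝ) < Real.pi / 2 by positivity)] with N hN hlt
      have hN' : (0 : ℝ) < N := by exact_mod_cast hN
      have hpos : 0 < √s / 2 / √(N : ℝ) := by positivity
      have e : ((√s / 2 : ℝ) : ℂ) * Complex.I / (√(N : ℝ) : ℝ) =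
          ((√s / 2 / √(N : ℝ) : ℝ) : ℂ) * Complex.I := by
        push_cast
        ring
      rw [e]
      exact ⟨cosh_mul_I_mul_ne_zero hpos hlt,
        fun P hP hr z hz => nonneg_of_isRoot_coshMean hP hr hpos hlt hz⟩
  · intro hr s hs z hz
    rcases hs.eq_or_lt with rfl | hs
    · rw [Complex.ofReal_zero, multHeat_zero] at hz
      exact hr z hz
    refine mem_of_isRoot_multHeat (S := {z : ℂ | ‖z‖ = 1})
      (isClosed_eq continuous_norm continuous_const) ⟨1, by simp⟩
      (b := ((√(-s) / 2 : ℝ) : ℂ)) ?_ ?_ hP hr hz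
    · rw [← Complex.ofReal_pow, div_pow, Real.sq_sqrt (by linarith)]
      push_cast
      ring
    · filter_upwards [eventually_gt_atTop 0] with N hN
      have hN' : (0 : ℝ) < N := by exact_mod_cast hN
      have hs' : 0 < -s := by linarith
      have hpos : 0 < √(-s) / 2 / √(N : ℝ) := by positivity
      rw [← Complex.ofReal_div]
      refine ⟨?_, fun P hP hr z hz => norm_eq_one_of_isRoot_coshMean hP hr hpos hz⟩
      rw [← Complex.ofReal_natCast, ← Complex.ofReal_mul, ← Complex.ofReal_cosh]
      exact Complex.ofReal_ne_zero.2 (Real.cosh_pos _).ne'
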